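/- **Formulas.** Formulas of the modal $\mu$-calculus are given by $\varphi ::= p \mid \bar p \mid x \mid \varphi\lor\varphi \mid \varphi\land\varphi \mid \Diamond\varphi \mid \Box\varphi \mid \mu x.\varphi \mid \nu x.\varphi$, with $p$ from a set of propositional variables and $x$ from a set $\mathsf{Var}$ of formal variables. For $\eta\in\{\mu,\nu\}$, $\varphi[\eta x.\varphi]$ denotes the result of replacing every free occurrence of $x$ in $\varphi$ by $\eta x.\varphi$. For a set $\Gamma$ of closed formulas (a sequent) let $\le$ be the subsumption order on formal variables, i.e. the reflexive transitive closure of the relation "$x$ occurs free in a subformula $\eta y.\psi$ of a formula in $\Gamma$". **Annotations.** For each $x\in\mathsf{Var}$ fix an infinite set $\mathsf N_x$ of names for $x$, these sets being pairwise disjoint, and let $\mathsf N=\bigcup_x\mathsf N_x$. For $a\in\mathsf N^*$ write $a\le x$ if $y\le x$ whenever a name from $\mathsf N_y$ occurs in $a$, and let $\sqsubseteq$ be the (scattered, reflexive) subword relation on $\mathsf N^*$. An annotated formula is $\varphi^a$ with $\varphi$ closed and $a\in\mathsf N^*$; an annotated sequent is a set of annotated formulas. **The system Clo.** Its rules (premises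 $\Rightarrow$ conclusion) are: - axiom: $p^\epsilon,\bar p^\epsilon$ (no premise); - $\lor$: $\Gamma,\varphi^a,\psi^a\Rightarrow\Gamma,(\varphi\lor\psi)^a$; - $\land$: $\Gamma,\varphi^a$ and $\Gamma,\psi^a\Rightarrow\Gamma,(\varphi\land\psi)^a$; - weakening: $\Gamma\Rightarrow\Gamma,\varphi^a$; - $\Box$: $\Gamma,\varphi^a\Rightarrow\Diamond\Gamma,(\Box\varphi)^a$, where $\Diamond\Gamma=\{(\Diamond\psi)^b : \psi^b\in\Gamma\}$; - $\eta\in\{\mu,\nu\}$: $\Gamma,\varphi[\eta x.\varphi]^a\Rightarrow\Gamma,(\eta x.\varphi)^a$, where $a\le x$; - exp: $\varphi_1^{a_1},\dots,\varphi_n^{a_n}\Rightarrow\varphi_1^{b_1},\dots,\varphi_n^{b_n}$, where $a_i\sqsubseteq b_i$ for all $i$; - discharge rule $\mathsf{clo}_{\mathsf x}$ with token $\mathsf x\in\mathsf N_x$: $\Gamma,\varphi[\nu x.\varphi]^{a\mathsf x}\Rightarrow\Gamma,(\nu x.\varphi)^a$, where $a\le x$ and $\mathsf x$ does not occur in $\Gamma$;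 above it, leaves labelled by the sequent $\Gamma,(\nu x.\varphi)^{a\mathsf x}$ and the token $\mathsf x$ may be discharged. A Clo derivation of a sequent $\Gamma$ is a (possibly infinite) tree built by these rules whose root is labelled by $\Gamma$ with all annotations empty, in which different discharge rules have different tokens and every leaf is either an axiom or a leaf labelled by a token $\mathsf x$ and discharged by a rule $\mathsf{clo}_{\mathsf x}$ at one of its ancestors. A Clo proof is a finite Clo derivation. **Statement.** Let $p$ be a propositional variable and $x\neq y$ formal variables, and let $$\nu x.\varphi = \nu x.\Diamond\bigl(\bar p\land(\Box x\lor\Diamond\,\nu y.\Box(p\land(\Box x\lor\Diamond y)))\bigr),\qquad \nu y.\psi=\nu y.\Box\bigl(p\land(\Box\,\nu x.\varphi\lor\Diamond y)\bigr),$$ and $\Phi=\{\nu x.\varphi,\ \nu y.\psi\}$. Then there is no Clo proof of $\Phi$; that is, every Clo derivation of $\Phi$ is infinite. -/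

import Mathlib

/-- Formulas of the modal `μ`-calculus over propositional variables `P` and formal variables `V`. -/
inductive MuFormula (P V : Type*) where
  | lit (p : P)
  | nlit (p : P)
  | var (x : V)
  | or (φ ψ : MuFormula P V)
  | and (φ ψ : MuFormula P V)
  | dia (φ : MuFormula P V)
  | box (φ : MuFormula P V)
  | mu (x : V) (φ : MuFormula P V)
  | nu (x : V) (φ : MuFormula P V)

namespace MuFormula

variable {P V : Type*}

/-- The formal variables that occur free in a formula. -/
def freeVars : MuFormula P V → Set V
  | lit _ => ∅
  | nlit _ => ∅
  | var x => {x}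
  | or φ ψ => φ.freeVars ∪ ψ.freeVars
  | and φ ψ => φ.freeVars ∪ ψ.freeVars
  | dia φ => φ.freeVars
  | box φ => φ.freeVars
  | mu x φ => φ.freeVars \ {x}
  | nu x φ => φ.freeVars \ {x}

/-- A formula is closed if every occurrence of a formal variable is bound. -/
def Closed (φ : MuFormula P V) : Prop := φ.freeVars = ∅

/-- The set of subformulas of a formula (including the formula itself). -/
def subformulas : MuFormula P V → Set (MuFormula P V)
  | lit p => {lit p}
  | nlit p => {nlit p}
  | var x => {var x}
  | or φ ψ => insert (or φ ψ) (φ.subformulas ∪ ψ.subformulas)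
  | and φ ψ => insert (and φ ψ) (φ.subformulas ∪ ψ.subformulas)
  | dia φ => insert (dia φ) φ.subformulas
  | box φ => insert (box φ) φ.subformulas
  | mu x φ => insert (mu x φ) φ.subformulas
  | nu x φ => insert (nu x φ) φ.subformulas

/-- `φ.subst x θ`: every free occurrence of `x` in `φ` is replaced by `θ`. It is only used for
closed `θ`, so that no variable can be captured. -/
def subst [DecidableEq V] (x : V) (θ : MuFormula P V) : MuFormula P V → MuFormula P V
  | lit p => lit p
  | nlit p => nlit p
  | var z => if z = x then θ else var z
  | or φ ψ => or (subst x θ φ) (subst x θ ψ)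
  | and φ ψ => and (subst x θ φ) (subst x θ ψ)
  | dia φ => dia (subst x θ φ)
  | box φ => box (subst x θ φ)
  | mu z φ => if z = x then mu z φ else mu z (subst x θ φ)
  | nu z φ => if z = x then nu z φ else nu z (subst x θ φ)

/-- The unfolding `φ[μx.φ]` of `μx.φ`. -/
def unfoldMu [DecidableEq V] (x : V) (φ : MuFormula P V) : MuFormula P V := subst x (mu x φ) φ

/-- The unfolding `φ[νx.φ]` of `νx.φ`. -/
def unfoldNu [DecidableEq V] (x : V) (φ : MuFormula P V) : MuFormula P V := subst x (nu x φ) φ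

/-- The subsumption order on formal variables determined by a set of formulas `Γ`: the reflexive
and transitive closure of "`x` occurs free in a subformula `ηy.ψ` of `Γ`". -/
def Subsumes (Γ : Set (MuFormula P V)) : V → V → Prop :=
  Relation.ReflTransGen fun x y =>
    ∃ γ ∈ Γ, ∃ ψ : MuFormula P V,
      (mu y ψ ∈ γ.subformulas ∧ x ∈ (mu y ψ).freeVars) ∨
      (nu y ψ ∈ γ.subformulas ∧ x ∈ (nu y ψ).freeVars)

end MuFormula

/-- An annotated formula `φ^a`: a formula with a finite word of names. -/
abbrev AnnFormula (P V N : Type*) := MuFormula P V × List N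

/-- An annotated sequent: a set of annotated formulas. -/
abbrev AnnSequent (P V N : Type*) := Set (AnnFormula P V N)

/-- `◇Γ`. -/
def AnnSequent.dia {P V N : Type*} (Γ : AnnSequent P V N) : AnnSequent P V N :=
  (fun f => (MuFormula.dia f.1, f.2)) '' Γ

/-- Instances of the rules of Clo, as labels of the nodes of a derivation. An `asm` label marks a
discharged assumption: a leaf that carries a sequent and a discharge token. -/
inductive CloRule (P V N : Type*) where
  | axLit (p : P)
  | or (Γ : AnnSequent P V N) (φ ψ : MuFormula P V) (a : List N)
  | and (Γ : AnnSequent P V N) (φ ψ : MuFormula P V) (a : List N)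
  | weak (Γ : AnnSequent P V N) (φ : MuFormula P V) (a : List N)
  | box (Γ : AnnSequent P V N) (φ : MuFormula P V) (a : List N)
  | mu (Γ : AnnSequent P V N) (x : V) (φ : MuFormula P V) (a : List N)
  | nu (Γ : AnnSequent P V N) (x : V) (φ : MuFormula P V) (a : List N)
  /-- A list of triples `(φᵢ, aᵢ, bᵢ)`. -/
  | exp (l : List (MuFormula P V × List N × List N))
  /-- The discharge rule with token `n`; its principal formula is `νx.φ^a` where `n` is a name
  for `x`. -/
  | clo (Γ : AnnSequent P V N) (n : N) (φ : MuFormula P V) (a : List N)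
  | asm (S : AnnSequent P V N) (n : N)

namespace CloRule

variable {P V N : Type*}

/-- The conclusion of a rule instance, where `nameVar n` is the formal variable that `n` is a
name for. -/
def conclusion (nameVar : N → V) : CloRule P V N → AnnSequent P V N
  | axLit p => {(MuFormula.lit p, []), (MuFormula.nlit p, [])}
  | or Γ φ ψ a => insert (MuFormula.or φ ψ, a) Γ
  | and Γ φ ψ a => insert (MuFormula.and φ ψ, a) Γ
  | weak Γ φ a => insert (φ, a) Γ
  | box Γ φ a => insert (MuFormula.box φ, a) Γ.dia
  | mu Γ x φ a => insert (MuFormula.mu x φ, a) Γ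
  | nu Γ x φ a => insert (MuFormula.nu x φ, a) Γ
  | exp l => {f | ∃ t ∈ l, f = (t.1, t.2.2)}
  | clo Γ n φ a => insert (MuFormula.nu (nameVar n) φ, a) Γ
  | asm S _ => S

/-- The list of premises of a rule instance. -/
def premises [DecidableEq V] (nameVar : N → V) : CloRule P V N → List (AnnSequent P V N)
  | axLit _ => []
  | or Γ φ ψ a => [insert (φ, a) (insert (ψ, a) Γ)]
  | and Γ φ ψ a => [insert (φ, a) Γ, insert (ψ, a) Γ]
  | weak Γ _ _ => [Γ]
  | box Γ φ a => [insert (φ, a) Γ]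
  | mu Γ x φ a => [insert (MuFormula.unfoldMu x φ, a) Γ]
  | nu Γ x φ a => [insert (MuFormula.unfoldNu x φ, a) Γ]
  | exp l => [{f | ∃ t ∈ l, f = (t.1, t.2.1)}]
  | clo Γ n φ a => [insert (MuFormula.unfoldNu (nameVar n) φ, a ++ [n]) Γ]
  | asm _ _ => []

/-- The side condition of a rule instance, with respect to an order `le` on formal variables. -/
def SideCondition (nameVar : N → V) (le : V → V → Prop) : CloRule P V N → Prop
  | mu _ x _ a => ∀ m ∈ a, le (nameVar m) x
  | nu _ x _ a => ∀ m ∈ a, le (nameVar m) x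
  | exp l => ∀ t ∈ l, t.2.1.Sublist t.2.2
  | clo Γ n _ a => (∀ m ∈ a, le (nameVar m) (nameVar n)) ∧ ∀ f ∈ Γ, n ∉ f.2
  | _ => True

end CloRule

/-- A (possibly infinite) Clo derivation of a sequent `Γ`. Nodes are addressed by finite sequences
of natural numbers, the root being `[]` and the `i`-th child of `u` being `u ++ [i]`;
`label u = none` means that `u` is not a node of the tree. -/
structure CloDerivation {P V N : Type*} [DecidableEq V] (nameVar : N → V)
    (Γ : Set (MuFormula P V)) where
  label : List ℕ → Option (CloRule P V N)
  /-- The root is a node, labelled by `Γ` with empty annotations. -/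
  root : (label []).map (CloRule.conclusion nameVar) = some ((fun φ => (φ, [])) '' Γ)
  /-- The children of a node correspond to the premises of the rule applied there. -/
  child : ∀ (u : List ℕ) (i : ℕ),
    (label (u ++ [i])).map (CloRule.conclusion nameVar) =
      (label u).bind fun r => (r.premises nameVar)[i]?
  side : ∀ (u : List ℕ) (r : CloRule P V N), label u = some r →
    r.SideCondition nameVar (MuFormula.Subsumes Γ)
  closed : ∀ (u : List ℕ) (r : CloRule P V N), label u = some r →
    ∀ f ∈ r.conclusion nameVar, f.1.Closed
  /-- Different discharge rules have different tokens. -/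
  token_unique : ∀ (u v : List ℕ) (n : N) (Δ Δ' : AnnSequent P V N) (φ φ' : MuFormula P V)
    (a a' : List N), label u = some (.clo Δ n φ a) → label v = some (.clo Δ' n φ' a') → u = v
  /-- A leaf with token `n` has an ancestor, its companion, labelled by the discharge rule with
  token `n`, and it carries the sequent that this rule discharges. -/
  discharged : ∀ (u : List ℕ) (S : AnnSequent P V N) (n : N), label u = some (.asm S n) →
    ∃ v, v <+: u ∧ ∃ (Δ : AnnSequent P V N) (φ : MuFormula P V) (a : List N),
      label v = some (.clo Δ n φ a) ∧ S = insert (MuFormula.nu (nameVar n) φ, a ++ [n]) Δ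

/-- A Clo proof is a finite Clo derivation. -/
def CloDerivation.IsProof {P V N : Type*} [DecidableEq V] {nameVar : N → V}
    {Γ : Set (MuFormula P V)} (ρ : CloDerivation nameVar Γ) : Prop :=
  {u : List ℕ | ρ.label u ≠ none}.Finite

namespace MuFormula

variable {P V : Type*}

/-- `νx.φ = νx.◇(¬p ∧ (□x ∨ ◇νy.□(p ∧ (□x ∨ ◇y))))`. -/
def nuXPhi (p : P) (x y : V) : MuFormula P V :=
  nu x (dia (and (nlit p) (or (box (var x))
    (dia (nu y (box (and (lit p) (or (box (var x)) (dia (var y))))))))))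

/-- `νy.ψ = νy.□(p ∧ (□νx.φ ∨ ◇y))`. -/
def nuYPsi (p : P) (x y : V) : MuFormula P V :=
  nu y (box (and (lit p) (or (box (nuXPhi p x y)) (dia (var y)))))

/-- The sequent `Φ = νx.φ, νy.ψ`. -/
def seqPhi (p : P) (x y : V) : Set (MuFormula P V) := {nuXPhi p x y, nuYPsi p x y}

end MuFormula

/-!
Every derivation has a branch that never ends. Call the token of a discharge rule alive as long as
all names of the sequent that the rule discharges are still present. Names never reappear, so the
token of a discharged leaf is alive there.

The refuting branch keeps each alive token on copies of a single unfolding, `◇(¬p ∧ …)` or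
`□(p ∧ …)`; this excludes discharged leaves, where a token sits on a fixpoint formula. Consider the
rule `□` applied to these unfoldings. If the `□` formula carried all names that keep one token alive
and the `◇` formulas those that keep another one alive, then the older token, being a name of the
sequent discharged by the younger one, would sit on both unfoldings. So on one side nothing is
alive, and the branch may give up the other side, by going to the literal in each of its
conjunctions. The other literal never appears, hence no axiom is reached, and when the two fixpoints
come back no token is alive.
-/

/-- The names that occur in an annotated sequent. -/
def AnnSequent.names {P V N : Type*} (S : AnnSequent P V N) : Set N := {n | ∃ f ∈ S, n ∈ f.2}

/-- The annotated formulas obtained from those of `S` by shrinking annotations, as the rules exp and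
weakening do. -/
def AnnSequent.shrinkings {P V N : Type*} (S : AnnSequent P V N) : AnnSequent P V N :=
  {f | ∃ g ∈ S, f.1 = g.1 ∧ f.2 ⊆ g.2}

namespace AnnSequent

variable {P V N : Type*} {S S' : AnnSequent P V N}

theorem names_mono (h : S ⊆ S') : S.names ⊆ S'.names :=
  fun _ ⟨f, hf, hn⟩ => ⟨f, h hf, hn⟩

theorem names_insert (φ : MuFormula P V) (a : List N) (Γ : AnnSequent P V N) :
    names (insert (φ, a) Γ) = {n | n ∈ a} ∪ Γ.names := by
  ext n
  simp [names]

theorem names_dia (Γ : AnnSequent P V N) : Γ.dia.names = Γ.names := by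
  ext n
  simp only [names, dia, Set.exists_mem_image]

theorem subset_shrinkings (S : AnnSequent P V N) : S ⊆ S.shrinkings :=
  fun f hf => ⟨f, hf, rfl, fun _ => id⟩

end AnnSequent

theorem CloRule.mem_names_of_mem_premises {P V N : Type*} [DecidableEq V] {nameVar : N → V}
    {le : V → V → Prop} {r : CloRule P V N} (hr : r.SideCondition nameVar le)
    {S : AnnSequent P V N} (hS : S ∈ r.premises nameVar) {m : N} (hm : m ∈ S.names) :
    m ∈ (r.conclusion nameVar).names ∨ ∃ Γ φ a, r = .clo Γ m φ a := by
  cases r with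
  | axLit | asm => simp [premises] at hS
  | exp l =>
    obtain rfl := List.mem_singleton.1 hS
    obtain ⟨_, ⟨t, ht, rfl⟩, hmt⟩ := hm
    exact .inl ⟨_, ⟨t, ht, rfl⟩, (hr t ht).subset hmt⟩
  | clo Γ n φ a =>
    obtain rfl := List.mem_singleton.1 hS
    simp only [conclusion, AnnSequent.names_insert, Set.mem_union, Set.mem_ofPred_eq,
      List.mem_append, List.mem_singleton] at hm ⊢
    rcases hm with (hma | rfl) | hmΓ
    · exact .inl (.inl hma)
    · exact .inr ⟨Γ, φ, a, rfl⟩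
    · exact .inl (.inr hmΓ)
  | and Γ φ ψ a =>
    have hprem : S = insert (φ, a) Γ ∨ S = insert (ψ, a) Γ := by simpa [premises] using hS
    left
    rcases hprem with rfl | rfl <;> simpa [conclusion, AnnSequent.names_insert] using hm
  | or | weak | box | mu | nu =>
    obtain rfl := List.mem_singleton.1 hS
    left
    simp_all [conclusion, AnnSequent.names_insert, AnnSequent.names_dia]

namespace CloDerivation

variable {P V N : Type*} [DecidableEq V] {nameVar : N → V} {Φ : Set (MuFormula P V)}

/-- The sequent at the node `u`, and the empty sequent if `u` is not a node. -/
def sequent (ρ : CloDerivation nameVar Φ) (u : List ℕ) : AnnSequent P V N :=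
  ((ρ.label u).map (CloRule.conclusion nameVar)).getD ∅

/-- The rule applied at `u` is a discharge rule with token `n`. -/
def Discharges (ρ : CloDerivation nameVar Φ) (u : List ℕ) (n : N) : Prop :=
  ∃ Γ φ a, ρ.label u = some (.clo Γ n φ a)

/-- The tokens of the discharge rules on the path to `u` whose discharged sequent has all its names,
that is, the token and the names of the conclusion of the rule, in `K`. The path includes `u`
itself; this is harmless for a set `K` of names occurring at `u`, where a token of `u` is fresh. -/
def aliveTokens (ρ : CloDerivation nameVar Φ) (u : List ℕ) (K : Set N) : Set N :=
  {n ∈ K | ∃ v, v <+: u ∧ ρ.Discharges v n ∧ (ρ.sequent v).names ⊆ K}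

variable (ρ : CloDerivation nameVar Φ) {u v w : List ℕ} {m n : N} {K L : Set N}

theorem sequent_eq {r : CloRule P V N} (hu : ρ.label u = some r) :
    ρ.sequent u = r.conclusion nameVar := by
  simp [sequent, hu]

theorem sequent_nil : ρ.sequent [] = (fun φ => (φ, [])) '' Φ := by
  simp [sequent, ρ.root]

theorem sequent_append {r : CloRule P V N} (hu : ρ.label u = some r) (i : ℕ) :
    ρ.sequent (u ++ [i]) = (r.premises nameVar)[i]?.getD ∅ := by
  simp [sequent, ρ.child, hu]

theorem label_append_ne_none {r : CloRule P V N} (hu : ρ.label u = some r) {i : ℕ}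
    (hi : i < (r.premises nameVar).length) : ρ.label (u ++ [i]) ≠ none := by
  intro h
  simpa [h, hu, hi] using ρ.child u i

theorem sequent_append_subset_of_weak {Γ : AnnSequent P V N} {φ : MuFormula P V} {a : List N}
    (hu : ρ.label u = some (.weak Γ φ a)) :
    ρ.sequent (u ++ [0]) ⊆ (ρ.sequent u).shrinkings := by
  rw [ρ.sequent_append hu, ρ.sequent_eq hu]
  exact (Set.subset_insert _ _).trans (AnnSequent.subset_shrinkings _)

theorem sequent_append_subset_of_exp {l : List (MuFormula P V × List N × List N)}
    (hu : ρ.label u = some (.exp l)) : ρ.sequent (u ++ [0]) ⊆ (ρ.sequent u).shrinkings := by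
  rw [ρ.sequent_append hu, ρ.sequent_eq hu]
  rintro _ ⟨t, ht, rfl⟩
  exact ⟨_, ⟨t, ht, rfl⟩, rfl, (ρ.side u _ hu t ht).subset⟩

theorem Discharges.eq {ρ : CloDerivation nameVar Φ} (hu : ρ.Discharges u n)
    (hv : ρ.Discharges v n) : u = v := by
  obtain ⟨_, _, _, hu⟩ := hu
  obtain ⟨_, _, _, hv⟩ := hv
  exact ρ.token_unique _ _ _ _ _ _ _ _ _ hu hv

theorem mem_names_or_discharges {i : ℕ} (hm : m ∈ (ρ.sequent (u ++ [i])).names) :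
    m ∈ (ρ.sequent u).names ∨ ρ.Discharges u m := by
  cases hu : ρ.label u with
  | none => simp [sequent, ρ.child, hu, AnnSequent.names] at hm
  | some r =>
    rw [ρ.sequent_append hu] at hm
    cases hS : (r.premises nameVar)[i]? with
    | none => simp [hS, AnnSequent.names] at hm
    | some S =>
      rw [hS, Option.getD_some] at hm
      rw [ρ.sequent_eq hu]
      have hSmem : S ∈ r.premises nameVar := List.mem_of_getElem? hS
      exact (CloRule.mem_names_of_mem_premises (ρ.side u r hu) hSmem hm).imp_right
        fun ⟨Γ, φ, a, hr⟩ => ⟨Γ, φ, a, hr ▸ hu⟩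

theorem exists_discharges_of_mem_names (hwu : w <+: u) (hu : m ∈ (ρ.sequent u).names)
    (hw : m ∉ (ρ.sequent w).names) : ∃ v, w <+: v ∧ v <+: u ∧ v ≠ u ∧ ρ.Discharges v m := by
  induction u using List.reverseRecOn with
  | nil => exact absurd (List.prefix_nil.1 hwu ▸ hu) hw
  | append_singleton u i ih =>
    rcases List.prefix_concat_iff.1 hwu with rfl | hwu
    · exact absurd hu hw
    rcases ρ.mem_names_or_discharges hu with hu | hu
    · obtain ⟨v, hwv, hvu, -, hv⟩ := ih hwu hu
      exact ⟨v, hwv, hvu.trans (List.prefix_append _ _),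
        fun h => by simpa [h] using hvu.length_le, hv⟩
    · exact ⟨u, hwu, List.prefix_append _ _, by simp, hu⟩

theorem Discharges.notMem_names {ρ : CloDerivation nameVar Φ} (hu : ρ.Discharges u n)
    (hvu : v <+: u) : n ∉ (ρ.sequent v).names := by
  intro hn
  obtain ⟨w, -, hwv, hne, hw⟩ := ρ.exists_discharges_of_mem_names List.nil_prefix hn
    (by simp [sequent_nil, AnnSequent.names])
  obtain rfl := hw.eq hu
  exact hne (hwv.eq_of_length_le hvu.length_le)

theorem aliveTokens_mono (h : K ⊆ L) : ρ.aliveTokens u K ⊆ ρ.aliveTokens u L :=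
  fun _ ⟨hn, v, hvu, hv, hK⟩ => ⟨h hn, v, hvu, hv, hK.trans h⟩

theorem aliveTokens_append_subset {i : ℕ} (hK : K ⊆ (ρ.sequent (u ++ [i])).names) :
    ρ.aliveTokens (u ++ [i]) K ⊆ ρ.aliveTokens u K := by
  rintro n ⟨hn, v, hvu, hv, hvK⟩
  rcases List.prefix_concat_iff.1 hvu with rfl | hvu
  · exact absurd (hK hn) (hv.notMem_names (List.prefix_refl _))
  · exact ⟨hn, v, hvu, hv, hvK⟩

theorem aliveTokens_append_eq_empty {i : ℕ} (hL : ρ.aliveTokens u L = ∅) (hKL : K ⊆ L)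
    (hK : K ⊆ (ρ.sequent (u ++ [i])).names) : ρ.aliveTokens (u ++ [i]) K = ∅ :=
  Set.subset_empty_iff.1
    (hL ▸ (ρ.aliveTokens_append_subset hK).trans (ρ.aliveTokens_mono hKL))

theorem mem_aliveTokens_or_discharges {i : ℕ}
    (hn : n ∈ ρ.aliveTokens (u ++ [i]) (ρ.sequent (u ++ [i])).names) :
    n ∈ ρ.aliveTokens u (ρ.sequent u).names ∨ ρ.Discharges u n := by
  obtain ⟨hn, v, hvu, hv, hsub⟩ := ρ.aliveTokens_append_subset subset_rfl hn
  refine (ρ.mem_names_or_discharges hn).imp_left fun hn => ⟨hn, v, hvu, hv, fun m hm => ?_⟩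
  exact (ρ.mem_names_or_discharges (hsub hm)).resolve_right fun hu => hu.notMem_names hvu hm

theorem mem_or_mem_of_mem_aliveTokens (hK : K ⊆ (ρ.sequent u).names)
    (hL : L ⊆ (ρ.sequent u).names) (hm : m ∈ ρ.aliveTokens u K) (hn : n ∈ ρ.aliveTokens u L) :
    m ∈ L ∨ n ∈ K := by
  obtain ⟨hmK, v, hvu, hv, hvK⟩ := hm
  obtain ⟨hnL, w, hwu, hw, hwL⟩ := hn
  by_contra! ⟨hmL, hnK⟩
  -- Each of the two rules would lie on the path above the other, so that they coincide.
  obtain ⟨v', hwv', -, -, hv'⟩ := ρ.exists_discharges_of_mem_names hwu (hK hmK) (mt (@hwL m) hmL)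
  obtain ⟨w', hvw', -, -, hw'⟩ := ρ.exists_discharges_of_mem_names hvu (hL hnL) (mt (@hvK n) hnK)
  obtain rfl := hv'.eq hv
  obtain rfl := hw'.eq hw
  obtain rfl := hwv'.eq_of_length_le hvw'.length_le
  obtain ⟨_, _, _, hv⟩ := hv
  obtain ⟨_, _, _, hw⟩ := hw
  obtain ⟨-, rfl, -⟩ := CloRule.clo.inj (Option.some_inj.1 (hv.symm.trans hw))
  exact hmL hnL

theorem mem_aliveTokens_of_label_eq_asm {S : AnnSequent P V N} (hu : ρ.label u = some (.asm S n)) :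
    n ∈ ρ.aliveTokens u S.names ∧ ∃ φ a, (.nu (nameVar n) φ, a) ∈ S ∧ n ∈ a := by
  obtain ⟨v, hvu, Γ, φ, a, hv, rfl⟩ := ρ.discharged u S n hu
  have hna : n ∈ a ++ [n] := by simp
  have hsub : (ρ.sequent v).names ⊆
      AnnSequent.names (insert (.nu (nameVar n) φ, a ++ [n]) Γ) := by
    rw [ρ.sequent_eq hv, CloRule.conclusion, AnnSequent.names_insert, AnnSequent.names_insert]
    exact Set.union_subset_union_left _ fun m hm => List.mem_append_left _ hm
  exact ⟨⟨⟨_, Set.mem_insert _ _, hna⟩, v, hvu, ⟨Γ, φ, a, hv⟩, hsub⟩,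
    φ, a ++ [n], Set.mem_insert _ _, hna⟩

end CloDerivation

theorem infinite_of_forall_exists_append_mem {α : Type*} {I : Set (List α)} (hne : I.Nonempty)
    (h : ∀ u ∈ I, ∃ a, u ++ [a] ∈ I) : I.Infinite := by
  intro hfin
  obtain ⟨u, hu, hmax⟩ := Set.exists_max_image I List.length hfin hne
  obtain ⟨a, ha⟩ := h u hu
  simpa using hmax _ ha

namespace MuFormula

variable {P V : Type*}

/-- `□νx.φ ∨ ◇νy.ψ`, the right conjunct in the unfoldings of both `νx.φ` and `νy.ψ`. -/
def continuation (p : P) (x y : V) : MuFormula P V :=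
  or (box (nuXPhi p x y)) (dia (nuYPsi p x y))

/-- `ℓ ∧ (□νx.φ ∨ ◇νy.ψ)`, which is the formula below the modality in the unfolding of `νx.φ` if `ℓ`
is `¬p`, and of `νy.ψ` if `ℓ` is `p`. -/
def body (p : P) (x y : V) (ℓ : MuFormula P V) : MuFormula P V := and ℓ (continuation p x y)

/-- The unfoldings of `νx.φ` and `νy.ψ`. -/
def unfoldings (p : P) (x y : V) : Set (MuFormula P V) :=
  {dia (body p x y (nlit p)), box (body p x y (lit p))}

/-- The formulas on the refuting branch between the modal step to the conjunctions and the next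
modal step, where `ℓ` is the only literal that the branch admits. -/
def booleanFormulas (p : P) (x y : V) (ℓ : MuFormula P V) : Set (MuFormula P V) :=
  {ℓ, body p x y (lit p), body p x y (nlit p), continuation p x y, box (nuXPhi p x y),
    dia (nuYPsi p x y)}

theorem unfoldNu_mem_unfoldings [DecidableEq V] {p : P} {x y z : V} {φ : MuFormula P V}
    (hxy : x ≠ y) (h : nu z φ ∈ seqPhi p x y) : unfoldNu z φ ∈ unfoldings p x y := by
  rcases h with h | h <;> obtain ⟨rfl, rfl⟩ := nu.inj h
  · simp [unfoldNu, subst, unfoldings, body, continuation, nuXPhi, nuYPsi, hxy.symm]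
  · simp [unfoldNu, subst, unfoldings, body, continuation, nuXPhi, nuYPsi, hxy]

end MuFormula

namespace CloDerivation

open MuFormula

variable {P V N : Type*} [DecidableEq V] {nameVar : N → V} {Φ : Set (MuFormula P V)}

/-- The invariant of the refuting branch at sequents over `νx.φ`, `νy.ψ` and their unfoldings: each
alive token occurs on copies of a single unfolding only. -/
structure FixpointPhase (ρ : CloDerivation nameVar Φ) (p : P) (x y : V) (u : List ℕ) : Prop where
  formula : ∀ f ∈ ρ.sequent u, f.1 ∈ seqPhi p x y ∪ unfoldings p x y
  unfolded : ∀ n ∈ ρ.aliveTokens u (ρ.sequent u).names, ∃ χ ∈ unfoldings p x y,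
    ∀ f ∈ ρ.sequent u, n ∈ f.2 → f.1 = χ

/-- The invariant of the refuting branch at sequents over the conjunctions and their components. Of
`ℓ ∧ (□νx.φ ∨ ◇νy.ψ)` the branch keeps only `ℓ`, so that the annotation is lost before the next
modal step; `dead` says that the remaining formulas keep no token alive. -/
structure BooleanPhase (ρ : CloDerivation nameVar Φ) (p : P) (x y : V) (ℓ : MuFormula P V)
    (u : List ℕ) : Prop where
  literal : ℓ = lit p ∨ ℓ = nlit p
  formula : ∀ f ∈ ρ.sequent u, f.1 ∈ booleanFormulas p x y ℓ
  dead : ρ.aliveTokens u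
    (AnnSequent.names {f ∈ ρ.sequent u | f.1 ∉ ({ℓ, body p x y ℓ} : Set _)}) = ∅

variable {ρ : CloDerivation nameVar Φ} {p : P} {x y : V} {ℓ : MuFormula P V} {u : List ℕ}

theorem FixpointPhase.append (h : ρ.FixpointPhase p x y u) {i : ℕ} {χ : MuFormula P V}
    (hχ : χ ∈ unfoldings p x y)
    (hstep : ∀ f ∈ ρ.sequent (u ++ [i]), f ∈ (ρ.sequent u).shrinkings ∨
      f.1 = χ ∧ ∃ g ∈ ρ.sequent u, g.1 ∉ unfoldings p x y ∧
        ∀ m ∈ f.2, m ∈ g.2 ∨ ρ.Discharges u m) :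
    ρ.FixpointPhase p x y (u ++ [i]) where
  formula f hf := by
    rcases hstep f hf with ⟨g, hg, hfg, -⟩ | ⟨rfl, -⟩
    · exact hfg ▸ h.formula g hg
    · exact .inr hχ
  unfolded n hn := by
    rcases ρ.mem_aliveTokens_or_discharges hn with hn | hn
    · obtain ⟨χ', hχ', hocc⟩ := h.unfolded n hn
      refine ⟨χ', hχ', fun f hf hnf => ?_⟩
      rcases hstep f hf with ⟨g, hg, hfg, hsub⟩ | ⟨-, g, hg, hgχ, hsub⟩
      · exact hfg.trans (hocc g hg (hsub hnf))
      · rcases hsub n hnf with hng | hnu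
        · exact absurd (hocc g hg hng ▸ hχ') hgχ
        · exact absurd hn.1 (hnu.notMem_names (List.prefix_refl u))
    · refine ⟨χ, hχ, fun f hf hnf => ?_⟩
      rcases hstep f hf with ⟨g, hg, -, hsub⟩ | ⟨hfχ, -⟩
      · exact absurd ⟨g, hg, hsub hnf⟩ (hn.notMem_names (List.prefix_refl u))
      · exact hfχ

theorem BooleanPhase.append (h : ρ.BooleanPhase p x y ℓ u) {i : ℕ}
    (hstep : ∀ f ∈ ρ.sequent (u ++ [i]), f ∈ (ρ.sequent u).shrinkings ∨
      f.1 ∈ booleanFormulas p x y ℓ ∧ (f.1 = ℓ ∨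
        ∃ g ∈ ρ.sequent u, g.1 ∉ ({ℓ, body p x y ℓ} : Set _) ∧ f.2 ⊆ g.2)) :
    ρ.BooleanPhase p x y ℓ (u ++ [i]) where
  literal := h.literal
  formula f hf := by
    rcases hstep f hf with ⟨g, hg, hfg, -⟩ | ⟨hfℓ, -⟩
    · exact hfg ▸ h.formula g hg
    · exact hfℓ
  dead := by
    refine ρ.aliveTokens_append_eq_empty h.dead ?_ (AnnSequent.names_mono (Set.sep_subset _ _))
    rintro n ⟨f, ⟨hf, hfℓ⟩, hnf⟩
    rcases hstep f hf with ⟨g, hg, hfg, hsub⟩ | ⟨-, rfl | ⟨g, hg, hgℓ, hsub⟩⟩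
    · exact ⟨g, ⟨hg, hfg ▸ hfℓ⟩, hsub hnf⟩
    · simp at hfℓ
    · exact ⟨g, ⟨hg, hgℓ⟩, hsub hnf⟩

theorem FixpointPhase.aliveTokens_eq_empty_or {Γ : AnnSequent P V N} {φ : MuFormula P V}
    {b : List N}
    (h : ρ.FixpointPhase p x y u) (hu : ρ.sequent u = insert (.box φ, b) Γ.dia) :
    ρ.aliveTokens u {n | n ∈ b} = ∅ ∨ ρ.aliveTokens u Γ.names = ∅ := by
  have hnames : (ρ.sequent u).names = {n | n ∈ b} ∪ Γ.names := by
    rw [hu, AnnSequent.names_insert, AnnSequent.names_dia]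
  have hb : {n | n ∈ b} ⊆ (ρ.sequent u).names := hnames ▸ Set.subset_union_left
  have hΓ : Γ.names ⊆ (ρ.sequent u).names := hnames ▸ Set.subset_union_right
  have not_shared : ∀ n ∈ ρ.aliveTokens u (ρ.sequent u).names, n ∈ b → n ∉ Γ.names := by
    rintro n hn hnb ⟨f, hf, hnf⟩
    obtain ⟨χ, -, hχ⟩ := h.unfolded n hn
    rw [hu] at hχ
    have hbox : .box φ = χ := hχ _ (Set.mem_insert _ _) hnb
    have hdia : .dia f.1 = χ :=
      hχ _ (Set.mem_insert_of_mem _ (Set.mem_image_of_mem _ hf)) hnf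
    exact nomatch hbox.trans hdia.symm
  by_contra! ⟨⟨m, hm⟩, n, hn⟩
  rcases ρ.mem_or_mem_of_mem_aliveTokens hb hΓ hm hn with hmΓ | hnb
  · exact not_shared m (ρ.aliveTokens_mono hb hm) hm.1 hmΓ
  · exact not_shared n (ρ.aliveTokens_mono hΓ hn) hnb hn.1

theorem FixpointPhase.booleanPhase_of_box {Γ : AnnSequent P V N} {φ : MuFormula P V} {b : List N}
    (h : ρ.FixpointPhase p x y u) (hu : ρ.label u = some (.box Γ φ b)) :
    ∃ ℓ, ρ.BooleanPhase p x y ℓ (u ++ [0]) := by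
  have hconcl : ρ.sequent u = insert (.box φ, b) Γ.dia := ρ.sequent_eq hu
  have hprem : ρ.sequent (u ++ [0]) = insert (φ, b) Γ := ρ.sequent_append hu 0
  have hφ : φ = body p x y (lit p) := by
    have := h.formula (.box φ, b) (hconcl ▸ Set.mem_insert _ _)
    simpa [seqPhi, unfoldings, nuXPhi, nuYPsi] using this
  have hΓ : ∀ f ∈ Γ, f.1 = body p x y (nlit p) := fun f hf => by
    have := h.formula (.dia f.1, f.2)
      (hconcl ▸ Set.mem_insert_of_mem _ (Set.mem_image_of_mem _ hf))
    simpa [seqPhi, unfoldings, nuXPhi, nuYPsi] using this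
  have hformula : ∀ ℓ, ∀ f ∈ ρ.sequent (u ++ [0]), f.1 ∈ booleanFormulas p x y ℓ := by
    intro ℓ f hf
    rcases hprem ▸ hf with rfl | hf
    · simp [booleanFormulas, hφ]
    · simp [booleanFormulas, hΓ f hf]
  rcases h.aliveTokens_eq_empty_or hconcl with hempty | hempty
  · refine ⟨nlit p, .inr rfl, hformula _, ρ.aliveTokens_append_eq_empty hempty ?_
      (AnnSequent.names_mono (Set.sep_subset _ _))⟩
    rintro n ⟨f, ⟨hf, hfℓ⟩, hnf⟩
    rcases hprem ▸ hf with rfl | hf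
    · exact hnf
    · exact absurd (.inr (hΓ f hf)) hfℓ
  · refine ⟨lit p, .inl rfl, hformula _, ρ.aliveTokens_append_eq_empty hempty ?_
      (AnnSequent.names_mono (Set.sep_subset _ _))⟩
    rintro n ⟨f, ⟨hf, hfℓ⟩, hnf⟩
    rcases hprem ▸ hf with rfl | hf
    · exact absurd (.inr hφ) hfℓ
    · exact ⟨f, hf, hnf⟩

theorem BooleanPhase.fixpointPhase_of_box {Γ : AnnSequent P V N} {φ : MuFormula P V} {a : List N}
    (h : ρ.BooleanPhase p x y ℓ u) (hu : ρ.label u = some (.box Γ φ a)) :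
    ρ.FixpointPhase p x y (u ++ [0]) := by
  have hconcl : ρ.sequent u = insert (.box φ, a) Γ.dia := ρ.sequent_eq hu
  have hprem : ρ.sequent (u ++ [0]) = insert (φ, a) Γ := ρ.sequent_append hu 0
  have hmodal : ∀ f ∈ ρ.sequent u, f.1 ∉ ({ℓ, body p x y ℓ} : Set _) := by
    rw [hconcl]
    rintro f (rfl | ⟨g, -, rfl⟩) <;> rcases h.literal with rfl | rfl <;> simp [body]
  have hnames : (ρ.sequent (u ++ [0])).names = (ρ.sequent u).names := by
    rw [hprem, hconcl, AnnSequent.names_insert, AnnSequent.names_insert, AnnSequent.names_dia]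
  have hdead : ρ.aliveTokens (u ++ [0]) (ρ.sequent (u ++ [0])).names = ∅ :=
    ρ.aliveTokens_append_eq_empty h.dead
      (hnames ▸ AnnSequent.names_mono fun f hf => ⟨hf, hmodal f hf⟩) subset_rfl
  refine ⟨fun f hf => .inl ?_, by simp [hdead]⟩
  rcases hprem ▸ hf with rfl | hf
  · have := h.formula (.box φ, a) (hconcl ▸ Set.mem_insert _ _)
    rcases h.literal with rfl | rfl <;>
      exact .inl (by simpa [booleanFormulas, body, continuation] using this)
  · have := h.formula (.dia f.1, f.2)
      (hconcl ▸ Set.mem_insert_of_mem _ (Set.mem_image_of_mem _ hf))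
    rcases h.literal with rfl | rfl <;>
      exact .inr (by simpa [booleanFormulas, body, continuation] using this)

theorem FixpointPhase.append_of_nu {Γ : AnnSequent P V N} {z : V} {φ : MuFormula P V}
    {a b : List N} {i : ℕ} (h : ρ.FixpointPhase p x y u) (hxy : x ≠ y)
    (hu : ρ.sequent u = insert (.nu z φ, a) Γ)
    (hi : ρ.sequent (u ++ [i]) = insert (unfoldNu z φ, b) Γ)
    (hb : ∀ m ∈ b, m ∈ a ∨ ρ.Discharges u m) : ρ.FixpointPhase p x y (u ++ [i]) := by
  have hnu : .nu z φ ∉ unfoldings p x y := by simp [unfoldings]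
  have hprincipal : (.nu z φ, a) ∈ ρ.sequent u := hu ▸ Set.mem_insert _ _
  have hseq := (h.formula _ hprincipal).resolve_right hnu
  refine h.append (unfoldNu_mem_unfoldings hxy hseq) fun f hf => ?_
  rcases hi ▸ hf with rfl | hf
  · exact .inr ⟨rfl, _, hprincipal, hnu, hb⟩
  · exact .inl (AnnSequent.subset_shrinkings _ (hu ▸ Set.mem_insert_of_mem _ hf))

theorem FixpointPhase.label_ne_asm (h : ρ.FixpointPhase p x y u) (S : AnnSequent P V N) (n : N) :
    ρ.label u ≠ some (.asm S n) := by
  intro hu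
  obtain ⟨hn, φ, a, hφ, hna⟩ := ρ.mem_aliveTokens_of_label_eq_asm hu
  have hS : ρ.sequent u = S := ρ.sequent_eq hu
  obtain ⟨χ, hχ, hocc⟩ := h.unfolded n (hS ▸ hn)
  have hnu : .nu (nameVar n) φ = χ := hocc _ (hS ▸ hφ) hna
  simp [← hnu, unfoldings] at hχ

theorem FixpointPhase.exists_child (h : ρ.FixpointPhase p x y u) (hxy : x ≠ y)
    (hu : ρ.label u ≠ none) : ∃ i, ρ.label (u ++ [i]) ≠ none ∧
      (ρ.FixpointPhase p x y (u ++ [i]) ∨ ∃ ℓ, ρ.BooleanPhase p x y ℓ (u ++ [i])) := by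
  obtain ⟨r, hr⟩ := Option.ne_none_iff_exists'.1 hu
  have hform : ∀ f ∈ r.conclusion nameVar, f.1 ∈ seqPhi p x y ∪ unfoldings p x y :=
    ρ.sequent_eq hr ▸ h.formula
  have hnode (hpos : 0 < (r.premises nameVar).length) := ρ.label_append_ne_none hr hpos
  have hχ : dia (body p x y (nlit p)) ∈ unfoldings p x y := Set.mem_insert _ _
  cases r with
  | axLit | or | and | mu =>
    simpa [seqPhi, unfoldings, nuXPhi, nuYPsi] using hform _ (Set.mem_insert _ _)
  | weak Γ φ a =>
    exact ⟨0, hnode one_pos, .inl (h.append hχ fun f hf =>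
      .inl (ρ.sequent_append_subset_of_weak hr hf))⟩
  | exp l =>
    exact ⟨0, hnode one_pos, .inl (h.append hχ fun f hf =>
      .inl (ρ.sequent_append_subset_of_exp hr hf))⟩
  | box Γ φ b => exact ⟨0, hnode one_pos, .inr (h.booleanPhase_of_box hr)⟩
  | nu Γ z φ a =>
    exact ⟨0, hnode one_pos, .inl (h.append_of_nu hxy (ρ.sequent_eq hr) (ρ.sequent_append hr 0)
      fun _ => .inl)⟩
  | clo Γ n φ a =>
    refine ⟨0, hnode one_pos, .inl (h.append_of_nu hxy (ρ.sequent_eq hr) (ρ.sequent_append hr 0)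
      fun m hm => (List.mem_append.1 hm).imp_right fun hmn => ?_)⟩
    exact List.mem_singleton.1 hmn ▸ ⟨Γ, φ, a, hr⟩
  | asm S n => exact absurd hr (h.label_ne_asm S n)

theorem BooleanPhase.append_of_or {Γ : AnnSequent P V N} {φ ψ : MuFormula P V} {a : List N}
    (h : ρ.BooleanPhase p x y ℓ u) (hu : ρ.label u = some (.or Γ φ ψ a)) :
    ρ.BooleanPhase p x y ℓ (u ++ [0]) := by
  have hconcl : ρ.sequent u = insert (.or φ ψ, a) Γ := ρ.sequent_eq hu
  have hprem : ρ.sequent (u ++ [0]) = insert (φ, a) (insert (ψ, a) Γ) := ρ.sequent_append hu 0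
  have hprincipal : (.or φ ψ, a) ∈ ρ.sequent u := hconcl ▸ Set.mem_insert _ _
  have hkept : .or φ ψ ∉ ({ℓ, body p x y ℓ} : Set _) := by
    rcases h.literal with rfl | rfl <;> simp [body]
  have hor : φ = box (nuXPhi p x y) ∧ ψ = dia (nuYPsi p x y) := by
    have := h.formula _ hprincipal
    rcases h.literal with rfl | rfl <;> simpa [booleanFormulas, body, continuation] using this
  refine h.append fun f hf => ?_
  rcases hprem ▸ hf with rfl | rfl | hf
  · exact .inr ⟨by simp [booleanFormulas, hor.1], .inr ⟨_, hprincipal, hkept, fun _ => id⟩⟩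
  · exact .inr ⟨by simp [booleanFormulas, hor.2], .inr ⟨_, hprincipal, hkept, fun _ => id⟩⟩
  · exact .inl (AnnSequent.subset_shrinkings _ (hconcl ▸ Set.mem_insert_of_mem _ hf))

theorem BooleanPhase.exists_append_of_and {Γ : AnnSequent P V N} {φ ψ : MuFormula P V}
    {a : List N} (h : ρ.BooleanPhase p x y ℓ u) (hu : ρ.label u = some (.and Γ φ ψ a)) :
    ∃ i < 2, ρ.BooleanPhase p x y ℓ (u ++ [i]) := by
  have hconcl : ρ.sequent u = insert (.and φ ψ, a) Γ := ρ.sequent_eq hu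
  have hleft : ρ.sequent (u ++ [0]) = insert (φ, a) Γ := ρ.sequent_append hu 0
  have hright : ρ.sequent (u ++ [1]) = insert (ψ, a) Γ := ρ.sequent_append hu 1
  have hprincipal : (.and φ ψ, a) ∈ ρ.sequent u := hconcl ▸ Set.mem_insert _ _
  have hside : ∀ f ∈ Γ, f ∈ (ρ.sequent u).shrinkings := fun f hf =>
    AnnSequent.subset_shrinkings _ (hconcl ▸ Set.mem_insert_of_mem _ hf)
  by_cases hφ : φ = ℓ
  · refine ⟨0, two_pos, h.append fun f hf => ?_⟩
    rcases hleft ▸ hf with rfl | hf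
    · exact .inr ⟨.inl hφ, .inl hφ⟩
    · exact .inl (hside f hf)
  · have hψ : ψ = continuation p x y := by
      have := h.formula _ hprincipal
      have hcases : φ = lit p ∧ ψ = continuation p x y ∨ φ = nlit p ∧ ψ = continuation p x y := by
        rcases h.literal with rfl | rfl <;> simpa [booleanFormulas, body, continuation] using this
      exact hcases.elim And.right And.right
    have hkept : .and φ ψ ∉ ({ℓ, body p x y ℓ} : Set _) := by
      rcases h.literal with rfl | rfl <;> simp [body, hφ]
    refine ⟨1, one_lt_two, h.append fun f hf => ?_⟩
    rcases hright ▸ hf with rfl | hf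
    · exact .inr ⟨by simp [booleanFormulas, hψ], .inr ⟨_, hprincipal, hkept, fun _ => id⟩⟩
    · exact .inl (hside f hf)

theorem BooleanPhase.exists_child (h : ρ.BooleanPhase p x y ℓ u) (hu : ρ.label u ≠ none) :
    ∃ i, ρ.label (u ++ [i]) ≠ none ∧
      (ρ.FixpointPhase p x y (u ++ [i]) ∨ ∃ ℓ, ρ.BooleanPhase p x y ℓ (u ++ [i])) := by
  obtain ⟨r, hr⟩ := Option.ne_none_iff_exists'.1 hu
  have hform : ∀ f ∈ r.conclusion nameVar, f.1 ∈ booleanFormulas p x y ℓ :=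
    ρ.sequent_eq hr ▸ h.formula
  have not_fixpoint : ∀ z φ, .mu z φ ∉ booleanFormulas p x y ℓ ∧
      .nu z φ ∉ booleanFormulas p x y ℓ := by
    rcases h.literal with rfl | rfl <;> simp [booleanFormulas, body, continuation]
  have hnode {i : ℕ} (hi : i < (r.premises nameVar).length) := ρ.label_append_ne_none hr hi
  cases r with
  | axLit q =>
    have hlit := hform (lit q, []) (.inl rfl)
    have hnlit := hform (nlit q, []) (.inr rfl)
    rcases h.literal with rfl | rfl <;> simp [booleanFormulas, body, continuation] at hlit hnlit
  | or Γ φ ψ a => exact ⟨0, hnode one_pos, .inr ⟨ℓ, h.append_of_or hr⟩⟩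
  | and Γ φ ψ a =>
    obtain ⟨i, hi, hchild⟩ := h.exists_append_of_and hr
    exact ⟨i, hnode hi, .inr ⟨ℓ, hchild⟩⟩
  | weak Γ φ a =>
    exact ⟨0, hnode one_pos, .inr ⟨ℓ, h.append fun f hf =>
      .inl (ρ.sequent_append_subset_of_weak hr hf)⟩⟩
  | exp l =>
    exact ⟨0, hnode one_pos, .inr ⟨ℓ, h.append fun f hf =>
      .inl (ρ.sequent_append_subset_of_exp hr hf)⟩⟩
  | box Γ φ a => exact ⟨0, hnode one_pos, .inl (h.fixpointPhase_of_box hr)⟩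
  | mu Γ z φ a => exact absurd (hform _ (Set.mem_insert _ _)) (not_fixpoint z φ).1
  | nu Γ z φ a => exact absurd (hform _ (Set.mem_insert _ _)) (not_fixpoint z φ).2
  | clo Γ n φ a => exact absurd (hform _ (Set.mem_insert _ _)) (not_fixpoint _ φ).2
  | asm S n =>
    obtain ⟨-, φ, a, hφ, -⟩ := ρ.mem_aliveTokens_of_label_eq_asm hr
    exact absurd (hform _ hφ) (not_fixpoint _ φ).2

theorem fixpointPhase_nil (ρ : CloDerivation nameVar Φ) (hΦ : Φ ⊆ seqPhi p x y) :
    ρ.FixpointPhase p x y [] where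
  formula f hf := by
    obtain ⟨φ, hφ, rfl⟩ := ρ.sequent_nil ▸ hf
    exact .inl (hΦ hφ)
  unfolded n hn := by
    have hnames : n ∈ (ρ.sequent []).names := hn.1
    simp [sequent_nil, AnnSequent.names] at hnames

end CloDerivation

theorem mainTheorem2_general {P V N : Type*} [DecidableEq V] {nameVar : N → V} {p : P} {x y : V}
    (hxy : x ≠ y) {Φ : Set (MuFormula P V)} (hΦ : Φ ⊆ MuFormula.seqPhi p x y)
    (ρ : CloDerivation nameVar Φ) : ¬ ρ.IsProof := by
  let I : Set (List ℕ) := {u | ρ.label u ≠ none ∧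
    (ρ.FixpointPhase p x y u ∨ ∃ ℓ, ρ.BooleanPhase p x y ℓ u)}
  have hroot : [] ∈ I := ⟨fun h => by simpa [h] using ρ.root, .inl (ρ.fixpointPhase_nil hΦ)⟩
  have hchild : ∀ u ∈ I, ∃ i, u ++ [i] ∈ I := by
    rintro u ⟨hu, hfix | ⟨ℓ, hbool⟩⟩
    · exact hfix.exists_child hxy hu
    · exact hbool.exists_child hu
  have hI : I.Infinite := infinite_of_forall_exists_append_mem ⟨[], hroot⟩ hchild
  exact hI.mono fun u hu => hu.1

theorem mainTheorem2 {P V N : Type*} [DecidableEq V] (nameVar : N → V)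
    (hN : ∀ z : V, {n : N | nameVar n = z}.Infinite) (p : P) (x y : V) (hxy : x ≠ y) :
    ¬ ∃ ρ : CloDerivation nameVar (MuFormula.seqPhi p x y), ρ.IsProof :=
  fun ⟨ρ, hρ⟩ => mainTheorem2_general hxy subset_rfl ρ hρ
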